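/- **Setting.** Let $X=[\mathbf x_1,\dots,\mathbf x_n]\in\mathbb R^{d\times n}$ and let $\mathrm{St}(d,K)=\{U\in\mathbb R^{d\times K}: U^\top U=I\}$. For $C\in\mathbb R^{d\times K}$, a *$U$-factor* of $C$ is a $U\in\mathrm{St}(d,K)$ such that $C=UH$ for some symmetric positive semidefinite $H\in\mathbb R^{K\times K}$; write $U\in\operatorname{PD}(C)$. Let $\|V\|_1=\sum_{i,j}|V_{ij}|$, let $\partial\|V\|_1$ be its convex subdifferential at $V$, and let $\operatorname{sgn}$ (with $\operatorname{sgn}(0)=0$) act entrywise. For the problem $\max\{\|X^\top U\|_1: U\in\mathrm{St}(d,K)\}$, a point $U\in\mathrm{St}(d,K)$ is a *KKT point* if $W=U\Lambda$ for some symmetric $\Lambda\in\mathbb R^{K\times K}$ and some $W\in X\,\partial\|V\|_1\big|_{V=X^\top U}$, and a *FOC point* if $U\in\operatorname{PD}(W)$ for some $W\in X\,\partial\|V\|_1\big|_{V=X^\top U}$. Given $\tau>0$, $\beta>0$, $\gamma\in[0,1)$, a sequence $(U^k,S^k,E^k)_{k\ge0}$ is *generated by PAMe* if $U^0\in\mathrm{St}(d,K)$,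 $S^0\in\{0,\pm1\}^{n\times K}$, $E^0\in\mathbb R^{d\times K}$ and, for all $k\ge 0$, $$S^{k+1}=\operatorname{sgn}(\tau S^k+X^\top E^k),\qquad U^{k+1}\in\operatorname{PD}(\beta U^k+XS^{k+1}),\qquad E^{k+1}=U^{k+1}-\gamma(U^k-U^{k+1}).$$ **Theorem.** There are $\tau_0>0$ and $\beta_0>0$, depending only on $X$ and $K$, such that for all $\tau>0$ and $\beta>0$ there is $\gamma_0>0$, depending only on $X,K,\tau,\beta$, with the following property. Let $\gamma\in[0,1)$, $\gamma<\gamma_0$, and let $(U^k,S^k,E^k)$ be generated by PAMe with parameters $\tau,\beta,\gamma$. Then: 1. After finitely many steps $S^k$ does not change: there is a first index $k'$ with $S^{k'}=S^{k'+1}=\cdots=:S^*$. 2. If $\tau<\tau_0$, then there is $U^*\in\mathrm{St}(d,K)$ with $U^*\in\operatorname{PD}(\beta U^*+XS^*)$ (so that $XS^*=U^*\Lambda$ with $\Lambda$ symmetric) and $S^*\in\partial\|V\|_1\big|_{V=X^\top U^*}$; in particular $U^*$ is a KKT point. 3. If furthermore $\beta<\beta_0$, then the $U^*$ of item 2 is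 a $U$-factor of $XS^*$ and is a FOC point. 4. If $\tau<\tau_0$, $\beta<\beta_0$ and $\operatorname{rank}(XS^*)=K$, then PAMe can be stopped at step $k'$ with output $\operatorname{PD}(XS^{k'})=\operatorname{PD}(XS^*)$: the $U$-factor of $XS^{k'}$ is unique, and it is a FOC point. -/

import Mathlib

namespace L1PCA

/-- Entrywise (Frobenius) inner product of two real matrices. -/
def frobInner {m k : ℕ} (A B : Matrix (Fin m) (Fin k) ℝ) : ℝ :=
  ∑ i, ∑ j, A i j * B i j

/-- Entrywise `L₁`-norm of a real matrix. -/
def oneNorm {m k : ℕ} (V : Matrix (Fin m) (Fin k) ℝ) : ℝ :=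
  ∑ i, ∑ j, |V i j|

/-- The convex subdifferential of the entrywise `L₁`-norm at `V`. -/
def subdiffOneNorm {m k : ℕ} (V : Matrix (Fin m) (Fin k) ℝ) :
    Set (Matrix (Fin m) (Fin k) ℝ) :=
  {G | ∀ Y, oneNorm V + frobInner G (Y - V) ≤ oneNorm Y}

/-- The Stiefel manifold `St(m, k)`. -/
def stiefel (m k : ℕ) : Set (Matrix (Fin m) (Fin k) ℝ) :=
  {U | U.transpose * U = 1}

/-- `U` is a `U`-factor of a polar decomposition `C = U H` (with `Uᵀ U = I` and `H` symmetric
positive semidefinite); this is the set-valued relation `U ∈ PD(C)`. -/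
def IsUFactor {m k : ℕ} (C U : Matrix (Fin m) (Fin k) ℝ) : Prop :=
  U ∈ stiefel m k ∧ ∃ H : Matrix (Fin k) (Fin k) ℝ, H.PosSemidef ∧ C = U * H

/-- KKT point of `max ‖Xᵀ U‖₁` subject to `U ∈ St(d, K)`. -/
def IsKKT {d n K : ℕ} (X : Matrix (Fin d) (Fin n) ℝ) (U : Matrix (Fin d) (Fin K) ℝ) : Prop :=
  U ∈ stiefel d K ∧ ∃ Λ : Matrix (Fin K) (Fin K) ℝ, Λ.IsSymm ∧
    ∃ G ∈ subdiffOneNorm (X.transpose * U), X * G = U * Λ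

/-- FOC point of the same problem: `U ∈ PD(W)` for some `W ∈ X ∂‖V‖₁` at `V = Xᵀ U`. -/
def IsFOC {d n K : ℕ} (X : Matrix (Fin d) (Fin n) ℝ) (U : Matrix (Fin d) (Fin K) ℝ) : Prop :=
  ∃ G ∈ subdiffOneNorm (X.transpose * U), IsUFactor (X * G) U

/-- `(U k, S k, E k)` is a sequence generated by PAMe. The initial `U`-iterate lies on the
Stiefel manifold, the initial sign variable has entries in `{-1, 0, 1}`, and `E 0` is arbitrary.
Any `U`-factor may be selected in the `U`-step. -/
structure IsPAMe {d n K : ℕ} (X : Matrix (Fin d) (Fin n) ℝ) (τ β γ : ℝ)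
    (U : ℕ → Matrix (Fin d) (Fin K) ℝ) (S : ℕ → Matrix (Fin n) (Fin K) ℝ)
    (E : ℕ → Matrix (Fin d) (Fin K) ℝ) : Prop where
  init_U : U 0 ∈ stiefel d K
  init_S : ∀ i j, S 0 i j = -1 ∨ S 0 i j = 0 ∨ S 0 i j = 1
  step_S : ∀ k, S (k + 1) = (τ • S k + X.transpose * E k).map Real.sign
  step_U : ∀ k, IsUFactor (β • U k + X * S (k + 1)) (U (k + 1))
  step_E : ∀ k, E (k + 1) = U (k + 1) - γ • (U k - U (k + 1))

end L1PCA

namespace L1PCA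

open Matrix Filter Topology

/-! ### The Frobenius inner product -/

/-! Two mechanisms carry the proof. Convergence: each S-step and U-step gains a multiple of the
squared increment. Extrapolation costs only a cross term with factor `γ`, which Young's inequality
absorbs for small `γ`. Hence a bounded `potential` increases (`IsPAMe.potential_step`) and
increments vanish. Sign matrices form a discrete set, so `S` stabilises at some T. Accumulation
points V of `U` satisfy V ∈ PD(βV + XT), and T is a subgradient at XᵀV up to an error of order τ
(`IsPAMe.exists_limit`). Exactness: for C = XT, the relation V ∈ PD(βV + C) makes VᵀC symmetric with
square CᵀC, so its eigenvalues are singular values of C up to sign. The shift β can therefore be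
lowered to one of finitely many values (`IsUFactor.exists_criticalShift`). For each sign matrix and
shift the admissible V form a compact set, on which the subgradient error has a minimum. A threshold
below all positive minima and all positive singular values turns a small error into an exact
subgradient at some admissible point, and a small β into shift 0 (`exists_thresholds`). -/

lemma frobInner_eq_trace {m k : ℕ} (A B : Matrix (Fin m) (Fin k) ℝ) :
    frobInner A B = (Aᵀ * B).trace := by
  simp only [frobInner, Matrix.trace, Matrix.diag, Matrix.mul_apply, Matrix.transpose_apply]
  exact Finset.sum_comm

lemma frobInner_comm {m k : ℕ} (A B : Matrix (Fin m) (Fin k) ℝ) :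
    frobInner A B = frobInner B A := by
  simp only [frobInner, mul_comm]

lemma frobInner_add_right {m k : ℕ} (A B C : Matrix (Fin m) (Fin k) ℝ) :
    frobInner A (B + C) = frobInner A B + frobInner A C := by
  simp only [frobInner_eq_trace, Matrix.mul_add, Matrix.trace_add]

lemma frobInner_sub_right {m k : ℕ} (A B C : Matrix (Fin m) (Fin k) ℝ) :
    frobInner A (B - C) = frobInner A B - frobInner A C := by
  simp only [frobInner_eq_trace, Matrix.mul_sub, Matrix.trace_sub]

lemma frobInner_smul_right {m k : ℕ} (c : ℝ) (A B : Matrix (Fin m) (Fin k) ℝ) :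
    frobInner A (c • B) = c * frobInner A B := by
  simp only [frobInner_eq_trace, Matrix.mul_smul, Matrix.trace_smul, smul_eq_mul]

lemma frobInner_sub_left {m k : ℕ} (A B C : Matrix (Fin m) (Fin k) ℝ) :
    frobInner (A - B) C = frobInner A C - frobInner B C := by
  simp only [frobInner_comm _ C, frobInner_sub_right]

lemma frobInner_transpose_mul_right {d n k : ℕ} (X : Matrix (Fin d) (Fin n) ℝ)
    (S : Matrix (Fin n) (Fin k) ℝ) (U : Matrix (Fin d) (Fin k) ℝ) :
    frobInner S (Xᵀ * U) = frobInner (X * S) U := by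
  simp only [frobInner_eq_trace, Matrix.transpose_mul, Matrix.mul_assoc]

lemma frobInner_self_nonneg {m k : ℕ} (A : Matrix (Fin m) (Fin k) ℝ) : 0 ≤ frobInner A A :=
  Finset.sum_nonneg fun _ _ => Finset.sum_nonneg fun _ _ => mul_self_nonneg _

lemma sq_apply_le_frobInner_self {m k : ℕ} (A : Matrix (Fin m) (Fin k) ℝ) (i : Fin m)
    (j : Fin k) : A i j ^ 2 ≤ frobInner A A := by
  have h₁ : A i j * A i j ≤ ∑ j, A i j * A i j :=
    Finset.single_le_sum (f := fun j => A i j * A i j) (fun _ _ => mul_self_nonneg _)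
      (Finset.mem_univ j)
  have h₂ : ∑ j, A i j * A i j ≤ frobInner A A :=
    Finset.single_le_sum (f := fun i => ∑ j, A i j * A i j)
      (fun _ _ => Finset.sum_nonneg fun _ _ => mul_self_nonneg _) (Finset.mem_univ i)
  rw [sq]
  exact h₁.trans h₂

lemma frobInner_sub_self {m k : ℕ} (A B : Matrix (Fin m) (Fin k) ℝ) :
    frobInner (A - B) (A - B) = frobInner A A - 2 * frobInner A B + frobInner B B := by
  rw [frobInner_sub_left, frobInner_sub_right, frobInner_sub_right, frobInner_comm B A]
  ring

/-- Young's inequality for the Frobenius inner product. -/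
lemma abs_mul_frobInner_le {m k : ℕ} (A B : Matrix (Fin m) (Fin k) ℝ) (c : ℝ) {b : ℝ}
    (hb : 0 < b) :
    |c * frobInner A B| ≤ b / 4 * frobInner B B + c ^ 2 / b * frobInner A A := by
  have key : ∀ c : ℝ, c * frobInner A B ≤ b / 4 * frobInner B B + c ^ 2 / b * frobInner A A := by
    intro c
    have h := frobInner_self_nonneg (c • A - (b / 2) • B)
    rw [frobInner_sub_self, frobInner_smul_right, frobInner_smul_right, frobInner_smul_right,
      frobInner_comm (c • A) A, frobInner_comm (c • A) B, frobInner_comm ((b / 2) • B) B,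
      frobInner_smul_right, frobInner_smul_right, frobInner_smul_right, frobInner_comm B A] at h
    have e : b / 4 * frobInner B B + c ^ 2 / b * frobInner A A - c * frobInner A B
        = (c * (c * frobInner A A) - 2 * (b / 2 * (c * frobInner A B))
          + b / 2 * (b / 2 * frobInner B B)) / b := by
      field_simp
      ring
    have := div_nonneg h hb.le
    linarith
  refine abs_le.2 ⟨?_, key c⟩
  have := key (-c)
  rw [neg_sq] at this
  linarith

lemma frobInner_mul_self_le {d n k : ℕ} (X : Matrix (Fin d) (Fin n) ℝ)
    (A : Matrix (Fin n) (Fin k) ℝ) :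
    frobInner (X * A) (X * A) ≤ frobInner X X * frobInner A A := by
  have hA : frobInner A A = ∑ j, ∑ l, A l j ^ 2 := by
    simp only [frobInner, sq]
    exact Finset.sum_comm
  rw [hA, frobInner, frobInner, Finset.sum_mul]
  refine Finset.sum_le_sum fun i _ => ?_
  rw [Finset.mul_sum]
  refine Finset.sum_le_sum fun j _ => ?_
  simp only [Matrix.mul_apply, ← sq]
  exact Finset.sum_mul_sq_le_sq_mul_sq _ _ _

/-! ### The Stiefel manifold and polar factors -/

lemma frobInner_self_of_mem_stiefel {m k : ℕ} {U : Matrix (Fin m) (Fin k) ℝ}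
    (hU : U ∈ stiefel m k) : frobInner U U = k := by
  have h : Uᵀ * U = 1 := hU
  rw [frobInner_eq_trace, h]
  simp

lemma isClosed_stiefel (m k : ℕ) : IsClosed (stiefel m k) :=
  isClosed_eq (by fun_prop) continuous_const

lemma isCompact_stiefel (m k : ℕ) : IsCompact (stiefel m k) := by
  have hc : IsCompact (Set.univ.pi fun _ : Fin m => Set.univ.pi fun _ : Fin k =>
      Set.Icc (-(k + 1 : ℝ)) (k + 1)) :=
    isCompact_univ_pi fun _ => isCompact_univ_pi fun _ => isCompact_Icc
  refine hc.of_isClosed_subset (isClosed_stiefel m k) fun U hU i _ j _ => ?_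
  have h := sq_apply_le_frobInner_self U i j
  rw [frobInner_self_of_mem_stiefel hU] at h
  exact abs_le.1 (abs_le_of_sq_le_sq (by nlinarith [(Nat.cast_nonneg k : (0 : ℝ) ≤ k)])
    (by positivity))

/-- Since UᵀU = I, the factor H is forced to be UᵀC. Removing the existential makes the relation
visibly closed. -/
lemma isUFactor_iff {m k : ℕ} {C U : Matrix (Fin m) (Fin k) ℝ} :
    IsUFactor C U ↔ U ∈ stiefel m k ∧ (Uᵀ * C).PosSemidef ∧ C = U * (Uᵀ * C) := by
  refine ⟨?_, fun h => ⟨h.1, _, h.2⟩⟩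
  rintro ⟨hU, H, hH, rfl⟩
  have h : Uᵀ * (U * H) = H := by
    rw [← Matrix.mul_assoc, show Uᵀ * U = 1 from hU, Matrix.one_mul]
  rw [h]
  exact ⟨hU, hH, rfl⟩

lemma isClosed_posSemidef (k : ℕ) :
    IsClosed {H : Matrix (Fin k) (Fin k) ℝ | H.PosSemidef} := by
  simp only [Matrix.posSemidef_iff_dotProduct_mulVec, Set.ofPred_and, Set.ofPred_forall,
    Matrix.IsHermitian]
  refine (isClosed_eq (by fun_prop) continuous_id).inter (isClosed_iInter fun x => ?_)
  exact isClosed_le continuous_const (by fun_prop)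

lemma isClosed_isUFactor (m k : ℕ) :
    IsClosed {p : Matrix (Fin m) (Fin k) ℝ × Matrix (Fin m) (Fin k) ℝ | IsUFactor p.1 p.2} := by
  simp only [isUFactor_iff, Set.ofPred_and]
  refine ((isClosed_stiefel m k).preimage continuous_snd).inter
    (((isClosed_posSemidef k).preimage ?_).inter (isClosed_eq ?_ ?_)) <;> fun_prop

/-- The trace of `(U - V) H (U - V)ᵀ` measures how far `V` is from maximizing
the inner product with `U H` over the Stiefel manifold. -/
lemma trace_sub_mul_mul_sub {m k : ℕ} {U V : Matrix (Fin m) (Fin k) ℝ}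
    (hU : U ∈ stiefel m k) (hV : V ∈ stiefel m k) {H : Matrix (Fin k) (Fin k) ℝ}
    (hH : H.PosSemidef) :
    ((U - V) * H * (U - V)ᵀ).trace = 2 * (frobInner U (U * H) - frobInner V (U * H)) := by
  have hHt : Hᵀ = H := hH.isHermitian
  have hU' : Uᵀ * U = 1 := hU
  have hV' : Vᵀ * V = 1 := hV
  have cyc : ∀ A B : Matrix (Fin m) (Fin k) ℝ, (A * H * Bᵀ).trace = (Bᵀ * A * H).trace := by
    intro A B
    rw [Matrix.trace_mul_comm, Matrix.mul_assoc]
  have hsym : (Uᵀ * V * H).trace = (Vᵀ * U * H).trace := by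
    rw [← Matrix.trace_transpose (Uᵀ * V * H)]
    simp only [Matrix.transpose_mul, Matrix.transpose_transpose, hHt]
    rw [Matrix.trace_mul_comm]
  simp only [Matrix.transpose_sub, Matrix.sub_mul, Matrix.mul_sub, Matrix.trace_sub, cyc,
    frobInner_eq_trace, hU', hV', hsym, ← Matrix.mul_assoc]
  ring

lemma IsUFactor.frobInner_le {m k : ℕ} {C U V : Matrix (Fin m) (Fin k) ℝ}
    (h : IsUFactor C U) (hV : V ∈ stiefel m k) : frobInner V C ≤ frobInner U C := by
  obtain ⟨hU, H, hH, rfl⟩ := h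
  have h₀ : 0 ≤ ((U - V) * H * (U - V)ᵀ).trace :=
    (hH.mul_mul_conjTranspose_same (U - V)).trace_nonneg
  rw [trace_sub_mul_mul_sub hU hV hH] at h₀
  linarith

/-- Both factors maximize the inner product with C, so the trace of (U - V)H(U - V)ᵀ vanishes. Full
rank makes H positive definite, which kills every row of U - V. -/
lemma IsUFactor.eq_of_rank_eq {m k : ℕ} {C U V : Matrix (Fin m) (Fin k) ℝ}
    (hC : C.rank = k) (hU : IsUFactor C U) (hV : IsUFactor C V) : V = U := by
  have heq : frobInner U C - frobInner V C = 0 :=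
    sub_eq_zero.2 (le_antisymm (hV.frobInner_le hU.1) (hU.frobInner_le hV.1))
  obtain ⟨hUs, H, hH, rfl⟩ := hU
  have hrank : H.rank = Fintype.card (Fin k) := by
    rw [Fintype.card_fin]
    exact le_antisymm (by simpa using H.rank_le_card_width)
      (hC.symm.le.trans (Matrix.rank_mul_le_right U H))
  have hunit : IsUnit H := by
    rw [← Matrix.mulVec_surjective_iff_isUnit]
    have htop : LinearMap.range H.mulVecLin = ⊤ := by
      apply Submodule.eq_top_of_finrank_eq
      rw [Module.finrank_fintype_fun_eq_card]
      exact hrank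
    exact LinearMap.range_eq_top.1 htop
  have hpd : H.PosDef := hH.posDef_iff_isUnit.2 hunit
  have htr : ((U - V) * H * (U - V)ᵀ).trace = 0 := by
    rw [trace_sub_mul_mul_sub hUs hV.1 hH, heq, mul_zero]
  have hzero : (U - V) * H * (U - V)ᵀ = 0 :=
    (hH.mul_mul_conjTranspose_same (U - V)).trace_eq_zero_iff.1 htr
  ext i j
  by_contra hne
  have hrow : (U - V) i ≠ 0 := by
    intro h0
    have h1 := congrFun h0 j
    simp only [Matrix.sub_apply, Pi.zero_apply] at h1
    exact hne (by linarith)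
  have hpos := hpd.dotProduct_mulVec_pos hrow
  have hii : ((U - V) * H * (U - V)ᵀ) i i = 0 := by rw [hzero]; rfl
  rw [Matrix.mul_assoc] at hii
  exact hpos.ne' hii

/-! ### Shifted polar factors -/

/-- Zero together with the singular values of `C`: the shifts `b` at which the set of `U` with
`U ∈ PD(b U + C)` can jump. -/
def criticalShifts {m k : ℕ} (C : Matrix (Fin m) (Fin k) ℝ) : Set ℝ :=
  {t | 0 ≤ t ∧ (t = 0 ∨ t ^ 2 ∈ spectrum ℝ (Cᵀ * C))}

lemma finite_criticalShifts {m k : ℕ} (C : Matrix (Fin m) (Fin k) ℝ) :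
    (criticalShifts C).Finite := by
  refine (((Matrix.finite_spectrum (Cᵀ * C)).image Real.sqrt).insert 0).subset ?_
  rintro t ⟨ht, rfl | h⟩
  · exact Set.mem_insert _ _
  · exact Set.mem_insert_of_mem _ ⟨_, h, Real.sqrt_sq ht⟩

lemma transpose_mul_smul_add {m k : ℕ} {C U : Matrix (Fin m) (Fin k) ℝ}
    (hU : U ∈ stiefel m k) (b : ℝ) : Uᵀ * (b • U + C) = b • 1 + Uᵀ * C := by
  rw [Matrix.mul_add, Matrix.mul_smul, show Uᵀ * U = 1 from hU]

lemma isUFactor_smul_add_iff {m k : ℕ} {C U : Matrix (Fin m) (Fin k) ℝ} {b : ℝ} :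
    IsUFactor (b • U + C) U ↔
      U ∈ stiefel m k ∧ (b • 1 + Uᵀ * C).PosSemidef ∧ C = U * (Uᵀ * C) := by
  rw [isUFactor_iff]
  refine and_congr_right fun hU => ?_
  rw [transpose_mul_smul_add hU, Matrix.mul_add, Matrix.mul_smul, Matrix.mul_one, add_right_inj]

lemma IsUFactor.smul_add_mono {m k : ℕ} {C U : Matrix (Fin m) (Fin k) ℝ} {b β : ℝ}
    (hb : b ≤ β) (h : IsUFactor (b • U + C) U) : IsUFactor (β • U + C) U := by
  rw [isUFactor_smul_add_iff] at h ⊢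
  refine ⟨h.1, ?_, h.2.2⟩
  have := (Matrix.PosSemidef.one (n := Fin k) (R := ℝ)).smul (sub_nonneg.2 hb)
  convert this.add h.2.1 using 1
  rw [sub_smul]
  abel

lemma IsUFactor.isSymm_transpose_mul {m k : ℕ} {C U : Matrix (Fin m) (Fin k) ℝ} {β : ℝ}
    (h : IsUFactor (β • U + C) U) : (Uᵀ * C).IsSymm := by
  have h' : (β • (1 : Matrix (Fin k) (Fin k) ℝ) + Uᵀ * C)ᵀ = β • 1 + Uᵀ * C :=
    (isUFactor_smul_add_iff.1 h).2.1.isHermitian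
  rw [Matrix.transpose_add, Matrix.transpose_smul, Matrix.transpose_one] at h'
  exact add_left_cancel h'

/-- This frees the thresholds from β: only finitely many shifts matter for a given C. -/
lemma IsUFactor.exists_criticalShift {m k : ℕ} {C U : Matrix (Fin m) (Fin k) ℝ} {β : ℝ}
    (hβ : 0 ≤ β) (h : IsUFactor (β • U + C) U) :
    ∃ b ∈ criticalShifts C, b ≤ β ∧ IsUFactor (b • U + C) U := by
  have hsymm := h.isSymm_transpose_mul
  rw [isUFactor_smul_add_iff] at h
  obtain ⟨hU, hpsd, hC⟩ := h
  obtain ⟨b, ⟨hbT, hbβ⟩, hmax⟩ := Set.exists_max_image (criticalShifts C ∩ Set.Iic β) id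
    ((finite_criticalShifts C).inter_of_left _) ⟨0, ⟨le_rfl, Or.inl rfl⟩, hβ⟩
  refine ⟨b, hbT, hbβ, isUFactor_smul_add_iff.2 ⟨hU, ?_, hC⟩⟩
  have hsq : (Uᵀ * C) ^ 2 = Cᵀ * C := by
    have hst : (Uᵀ * C)ᵀ = Cᵀ * U := by rw [Matrix.transpose_mul, Matrix.transpose_transpose]
    rw [sq]
    nth_rewrite 1 [← hsymm.eq]
    rw [hst, Matrix.mul_assoc, ← hC]
  have hshift : ∀ c a : ℝ, a ∈ spectrum ℝ (c • 1 + Uᵀ * C) ↔ a - c ∈ spectrum ℝ (Uᵀ * C) := by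
    intro c a
    rw [← Algebra.algebraMap_eq_smul_one, sub_eq_add_neg, spectrum.add_mem_iff, map_neg, neg_neg]
  rw [Matrix.posSemidef_iff_isHermitian_and_spectrum_nonneg]
  constructor
  · change (b • (1 : Matrix (Fin k) (Fin k) ℝ) + Uᵀ * C)ᵀ = _
    rw [Matrix.transpose_add, Matrix.transpose_smul, Matrix.transpose_one, hsymm.eq]
  · intro a ha
    -- An eigenvalue `a < 0` would make `b - a` a critical shift lying above `b` and at most `β`,
    -- against the maximality of `b`.
    by_contra hneg
    have hneg : a < 0 := not_le.1 hneg
    rw [hshift] at ha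
    have hmem : (a - b) ^ 2 ∈ spectrum ℝ (Cᵀ * C) := hsq ▸ spectrum.pow_mem_pow _ 2 ha
    have hge : 0 ≤ a - b + β := by
      refine (Matrix.posSemidef_iff_isHermitian_and_spectrum_nonneg.1 hpsd).2 ?_
      rw [hshift]
      simpa using ha
    have hb0 : 0 ≤ b := hbT.1
    have hle : b - a ≤ b := hmax (b - a) ⟨⟨by linarith, Or.inr (by rwa [← neg_sub, neg_sq])⟩,
      Set.mem_Iic.2 (by linarith)⟩
    linarith

/-! ### Subgradients of the entrywise `L₁`-norm -/

lemma mem_subdiffOneNorm {m k : ℕ} {S V : Matrix (Fin m) (Fin k) ℝ} (hS : ∀ i j, |S i j| ≤ 1)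
    (h : oneNorm V - frobInner S V ≤ 0) : S ∈ subdiffOneNorm V := by
  intro Y
  have hY : frobInner S Y ≤ oneNorm Y := by
    refine Finset.sum_le_sum fun i _ => Finset.sum_le_sum fun j _ => ?_
    calc S i j * Y i j ≤ |S i j| * |Y i j| := (le_abs_self _).trans (abs_mul _ _).le
      _ ≤ |Y i j| := mul_le_of_le_one_left (abs_nonneg _) (hS i j)
  rw [frobInner_sub_right]
  linarith

/-- The matrices with entries in `{-1, 0, 1}`. -/
def signMatrices (m k : ℕ) : Set (Matrix (Fin m) (Fin k) ℝ) :=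
  {S | ∀ i j, S i j = -1 ∨ S i j = 0 ∨ S i j = 1}

lemma finite_signMatrices (m k : ℕ) : (signMatrices m k).Finite := by
  have h : (Set.univ.pi fun _ : Fin m =>
      Set.univ.pi fun _ : Fin k => ({-1, 0, 1} : Set ℝ)).Finite :=
    Set.Finite.pi fun _ => Set.Finite.pi fun _ => Set.toFinite _
  refine h.subset fun S hS i _ j _ => ?_
  simpa using hS i j

lemma abs_le_one_of_mem_signMatrices {m k : ℕ} {S : Matrix (Fin m) (Fin k) ℝ}
    (hS : S ∈ signMatrices m k) (i : Fin m) (j : Fin k) : |S i j| ≤ 1 := by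
  rcases hS i j with h | h | h <;> simp [h]

lemma continuous_oneNorm_sub_frobInner {d n k : ℕ} (X : Matrix (Fin d) (Fin n) ℝ)
    (S : Matrix (Fin n) (Fin k) ℝ) :
    Continuous fun U : Matrix (Fin d) (Fin k) ℝ => oneNorm (Xᵀ * U) - frobInner S (Xᵀ * U) := by
  unfold oneNorm frobInner
  fun_prop

lemma isCompact_setOf_isUFactor_smul_add {m k : ℕ} (C : Matrix (Fin m) (Fin k) ℝ) (b : ℝ) :
    IsCompact {U | IsUFactor (b • U + C) U} := by
  refine (isCompact_stiefel m k).of_isClosed_subset ?_ fun U hU => hU.1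
  exact (isClosed_isUFactor m k).preimage
    (f := fun U : Matrix (Fin m) (Fin k) ℝ => (b • U + C, U)) (by fun_prop)

/-- For a fixed sign matrix and shift, an approximate subgradient relation with a small enough
error forces an exact one, at a possibly different `U`. -/
lemma eventually_exists_mem_subdiffOneNorm {d n k : ℕ} (X : Matrix (Fin d) (Fin n) ℝ)
    {S : Matrix (Fin n) (Fin k) ℝ} (hS : S ∈ signMatrices n k) (b : ℝ) :
    ∀ᶠ ε in 𝓝[>] (0 : ℝ), ∀ U, IsUFactor (b • U + X * S) U →
      oneNorm (Xᵀ * U) - frobInner S (Xᵀ * U) ≤ ε →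
      ∃ V, IsUFactor (b • V + X * S) V ∧ S ∈ subdiffOneNorm (Xᵀ * V) := by
  rcases Set.eq_empty_or_nonempty {U : Matrix (Fin d) (Fin k) ℝ | IsUFactor (b • U + X * S) U}
    with hemp | hne
  · exact Eventually.of_forall fun ε U hU => (Set.eq_empty_iff_forall_notMem.1 hemp U hU).elim
  obtain ⟨V, hV, hmin⟩ := (isCompact_setOf_isUFactor_smul_add (X * S) b).exists_isMinOn hne
    (continuous_oneNorm_sub_frobInner X S).continuousOn
  by_cases h0 : oneNorm (Xᵀ * V) - frobInner S (Xᵀ * V) ≤ 0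
  · exact Eventually.of_forall fun ε U _ _ =>
      ⟨V, hV, mem_subdiffOneNorm (abs_le_one_of_mem_signMatrices hS) h0⟩
  · filter_upwards [Ioo_mem_nhdsGT (not_le.1 h0)] with ε hε U hU hUε
    exact absurd (hmin hU) (not_le.2 (hUε.trans_lt hε.2))

/-- Uniform thresholds for the error of an approximate subgradient relation and for the shift. -/
lemma exists_thresholds {d n k : ℕ} (X : Matrix (Fin d) (Fin n) ℝ) :
    ∃ ε : ℝ, 0 < ε ∧ ∀ S ∈ signMatrices n k, ∀ b ∈ criticalShifts (X * S),
      (b < ε → b = 0) ∧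
      ∀ U, IsUFactor (b • U + X * S) U →
        oneNorm (Xᵀ * U) - frobInner S (Xᵀ * U) ≤ ε →
        ∃ V, IsUFactor (b • V + X * S) V ∧ S ∈ subdiffOneNorm (Xᵀ * V) := by
  have h : ∀ᶠ ε in 𝓝[>] (0 : ℝ), ∀ S ∈ signMatrices n k, ∀ b ∈ criticalShifts (X * S),
      (b < ε → b = 0) ∧
      ∀ U, IsUFactor (b • U + X * S) U →
        oneNorm (Xᵀ * U) - frobInner S (Xᵀ * U) ≤ ε →
        ∃ V, IsUFactor (b • V + X * S) V ∧ S ∈ subdiffOneNorm (Xᵀ * V) := by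
    refine (eventually_all_finite (finite_signMatrices n k)).2 fun S hS =>
      (eventually_all_finite (finite_criticalShifts _)).2 fun b hb =>
        Eventually.and ?_ (eventually_exists_mem_subdiffOneNorm X hS b)
    rcases hb.1.eq_or_lt with h0 | hpos
    · exact Eventually.of_forall fun _ _ => h0.symm
    · filter_upwards [Ioo_mem_nhdsGT hpos] with ε hε hlt
      exact absurd hlt (not_lt.2 hε.2.le)
  obtain ⟨ε, hε, hpos⟩ := (h.and self_mem_nhdsWithin).exists
  exact ⟨ε, hpos, hε⟩

/-! ### The PAMe iteration -/

/-- With y = τs + x, the difference of the two sides is (sgn y - s) y = |y| - s y, nonnegative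
because |s| ≤ 1. -/
lemma sign_step_gain {τ s x : ℝ} (hs : s = -1 ∨ s = 0 ∨ s = 1) :
    τ / 2 * ((Real.sign (τ * s + x) - s) * (Real.sign (τ * s + x) - s)) ≤
      (Real.sign (τ * s + x) - s) * x +
        τ / 2 * (Real.sign (τ * s + x) * Real.sign (τ * s + x) - s * s) := by
  rcases lt_trichotomy (τ * s + x) 0 with h | h | h
  · rw [Real.sign_of_neg h]
    rcases hs with rfl | rfl | rfl <;> linarith
  · rw [h, Real.sign_zero]
    rcases hs with rfl | rfl | rfl <;> linarith
  · rw [Real.sign_of_pos h]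
    rcases hs with rfl | rfl | rfl <;> linarith

/-- At a fixed point, `x` can have the sign opposite to `s` only while |x| < τ, and `s = 0` forces
`x = 0`. -/
lemma abs_le_of_sign_eq {τ s x : ℝ} (hτ : 0 < τ) (h : s = Real.sign (τ * s + x)) :
    |x| ≤ s * x + 2 * τ := by
  rcases lt_trichotomy (τ * s + x) 0 with h' | h' | h'
  · rw [Real.sign_of_neg h'] at h
    subst h
    exact abs_le.2 ⟨by linarith, by linarith⟩
  · rw [h', Real.sign_zero] at h
    subst h
    have : x = 0 := by linarith
    subst this
    simpa using hτ.le
  · rw [Real.sign_of_pos h'] at h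
    subst h
    exact abs_le.2 ⟨by linarith, by linarith⟩

variable {d n K : ℕ} {X : Matrix (Fin d) (Fin n) ℝ} {τ β γ : ℝ}
  {U : ℕ → Matrix (Fin d) (Fin K) ℝ} {S : ℕ → Matrix (Fin n) (Fin K) ℝ}
  {E : ℕ → Matrix (Fin d) (Fin K) ℝ}

lemma IsPAMe.apply_S (h : IsPAMe X τ β γ U S E) (k : ℕ) (i : Fin n) (j : Fin K) :
    S (k + 1) i j = Real.sign (τ * S k i j + (Xᵀ * E k) i j) := by
  rw [h.step_S k]
  rfl

lemma IsPAMe.mem_signMatrices (h : IsPAMe X τ β γ U S E) (k : ℕ) : S k ∈ signMatrices n K := by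
  cases k with
  | zero => exact h.init_S
  | succ k =>
    intro i j
    rw [h.apply_S]
    exact Real.sign_apply_eq _

lemma IsPAMe.mem_stiefel (h : IsPAMe X τ β γ U S E) (k : ℕ) : U k ∈ stiefel d K := by
  cases k with
  | zero => exact h.init_U
  | succ k => exact (h.step_U k).1

lemma IsPAMe.S_step_gain (h : IsPAMe X τ β γ U S E) (k : ℕ) :
    τ / 2 * frobInner (S (k + 1) - S k) (S (k + 1) - S k) ≤
      frobInner (S (k + 1) - S k) (Xᵀ * E k) +
        τ / 2 * (frobInner (S (k + 1)) (S (k + 1)) - frobInner (S k) (S k)) := by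
  simp only [frobInner, ← Finset.sum_sub_distrib, Finset.mul_sum, ← Finset.sum_add_distrib]
  refine Finset.sum_le_sum fun i _ => Finset.sum_le_sum fun j _ => ?_
  simp only [Matrix.sub_apply, h.apply_S k]
  exact sign_step_gain (h.mem_signMatrices k i j)

/-- The new iterate is compared with the old one as a competitor. All iterates have the same
Frobenius norm, so the proximal inner product becomes a squared distance. -/
lemma IsPAMe.U_step_gain (h : IsPAMe X τ β γ U S E) (k : ℕ) :
    β / 2 * frobInner (U (k + 1) - U k) (U (k + 1) - U k) ≤
      frobInner (X * S (k + 1)) (U (k + 1)) - frobInner (X * S (k + 1)) (U k) := by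
  have hmax := (h.step_U k).frobInner_le (h.mem_stiefel k)
  rw [frobInner_add_right, frobInner_add_right, frobInner_smul_right, frobInner_smul_right,
    frobInner_self_of_mem_stiefel (h.mem_stiefel k), frobInner_comm _ (X * _),
    frobInner_comm _ (X * _)] at hmax
  rw [frobInner_sub_self, frobInner_self_of_mem_stiefel (h.mem_stiefel k),
    frobInner_self_of_mem_stiefel (h.mem_stiefel (k + 1))]
  linarith

/-- The objective at step `k + 1`, corrected so that it increases along the iteration. -/
noncomputable def potential (X : Matrix (Fin d) (Fin n) ℝ) (τ β : ℝ)
    (U : ℕ → Matrix (Fin d) (Fin K) ℝ) (S : ℕ → Matrix (Fin n) (Fin K) ℝ) (k : ℕ) : ℝ :=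
  frobInner (X * S (k + 1)) (U (k + 1)) + τ / 2 * frobInner (S (k + 1)) (S (k + 1)) -
    β / 4 * frobInner (U (k + 1) - U k) (U (k + 1) - U k)

lemma IsPAMe.potential_step (h : IsPAMe X τ β γ U S E) (hβ : 0 < β)
    (hγ : γ ^ 2 / β * frobInner X X ≤ τ / 4) (k : ℕ) :
    τ / 4 * frobInner (S (k + 2) - S (k + 1)) (S (k + 2) - S (k + 1)) +
        β / 4 * frobInner (U (k + 2) - U (k + 1)) (U (k + 2) - U (k + 1)) ≤
      potential X τ β U S (k + 1) - potential X τ β U S k := by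
  have hS := h.S_step_gain (k + 1)
  have hU := h.U_step_gain (k + 1)
  -- Only positive indices have this form; `E 0` is arbitrary, which is why the potential starts at
  -- step 1.
  have hE : E (k + 1) = U (k + 1) + γ • (U (k + 1) - U k) := by
    rw [h.step_E, ← neg_sub (U (k + 1)) (U k), smul_neg, sub_neg_eq_add]
  rw [frobInner_transpose_mul_right, hE, frobInner_add_right, frobInner_smul_right] at hS
  have hY := (abs_le.1 (abs_mul_frobInner_le (X * (S (k + 1 + 1) - S (k + 1)))
    (U (k + 1) - U k) γ hβ)).2
  have hX : γ ^ 2 / β * frobInner (X * (S (k + 1 + 1) - S (k + 1)))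
        (X * (S (k + 1 + 1) - S (k + 1))) ≤
      τ / 4 * frobInner (S (k + 1 + 1) - S (k + 1)) (S (k + 1 + 1) - S (k + 1)) := by
    refine (mul_le_mul_of_nonneg_left (frobInner_mul_self_le _ _) (by positivity)).trans ?_
    rw [← mul_assoc]
    exact mul_le_mul_of_nonneg_right hγ (frobInner_self_nonneg _)
  have hsplit : frobInner (X * (S (k + 1 + 1) - S (k + 1))) (U (k + 1)) =
      frobInner (X * S (k + 1 + 1)) (U (k + 1)) - frobInner (X * S (k + 1)) (U (k + 1)) := by
    rw [Matrix.mul_sub, frobInner_sub_left]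
  simp only [potential]
  linarith

lemma frobInner_self_le_of_mem_signMatrices {m k : ℕ} {A : Matrix (Fin m) (Fin k) ℝ}
    (hA : A ∈ signMatrices m k) : frobInner A A ≤ m * k := by
  calc frobInner A A ≤ ∑ _i : Fin m, ∑ _j : Fin k, (1 : ℝ) :=
        Finset.sum_le_sum fun i _ => Finset.sum_le_sum fun j _ => by
          rcases hA i j with h | h | h <;> simp [h]
    _ = m * k := by simp

lemma IsPAMe.bddAbove_potential (h : IsPAMe X τ β γ U S E) (hτ : 0 < τ) (hβ : 0 < β) :
    BddAbove (Set.range (potential X τ β U S)) := by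
  refine ⟨K + frobInner X X * (n * K) + τ / 2 * (n * K), ?_⟩
  rintro _ ⟨k, rfl⟩
  have h₁ := (abs_le.1 (abs_mul_frobInner_le (X * S (k + 1)) (U (k + 1)) 1
    (b := 4) (by norm_num))).2
  have h₂ := frobInner_mul_self_le X (S (k + 1))
  have h₃ := frobInner_self_le_of_mem_signMatrices (h.mem_signMatrices (k + 1))
  have h₄ := mul_le_mul_of_nonneg_left h₃ (frobInner_self_nonneg X)
  have h₅ := mul_le_mul_of_nonneg_left h₃ (half_pos hτ).le
  have h₆ : 0 ≤ β / 4 * frobInner (U (k + 1) - U k) (U (k + 1) - U k) :=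
    mul_nonneg (by positivity) (frobInner_self_nonneg _)
  have h₇ := frobInner_self_nonneg (X * S (k + 1))
  rw [frobInner_self_of_mem_stiefel (h.mem_stiefel (k + 1))] at h₁
  simp only [potential]
  linarith

lemma tendsto_zero_of_le_sub {a Φ : ℕ → ℝ} (ha : ∀ k, 0 ≤ a k)
    (hΦ : ∀ k, a k ≤ Φ (k + 1) - Φ k) (hb : BddAbove (Set.range Φ)) :
    Tendsto a atTop (𝓝 0) := by
  have hmono : Monotone Φ := monotone_nat_of_le_succ fun k => by linarith [ha k, hΦ k]
  have hlim := tendsto_atTop_ciSup hmono hb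
  have hdiff := (hlim.comp (tendsto_add_atTop_nat 1)).sub hlim
  rw [sub_self] at hdiff
  exact squeeze_zero ha hΦ hdiff

lemma IsPAMe.tendsto_frobInner_S (h : IsPAMe X τ β γ U S E) (hτ : 0 < τ) (hβ : 0 < β)
    (hγ : γ ^ 2 / β * frobInner X X ≤ τ / 4) :
    Tendsto (fun k => frobInner (S (k + 2) - S (k + 1)) (S (k + 2) - S (k + 1)))
      atTop (𝓝 0) := by
  have := tendsto_zero_of_le_sub
    (a := fun k => τ / 4 * frobInner (S (k + 2) - S (k + 1)) (S (k + 2) - S (k + 1)))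
    (fun k => mul_nonneg (by positivity) (frobInner_self_nonneg _))
    (fun k => le_trans (le_add_of_nonneg_right (mul_nonneg (by positivity)
      (frobInner_self_nonneg _))) (h.potential_step hβ hγ k)) (h.bddAbove_potential hτ hβ)
  simpa [← mul_assoc, hτ.ne'] using this.const_mul (4 / τ)

lemma IsPAMe.tendsto_frobInner_U (h : IsPAMe X τ β γ U S E) (hτ : 0 < τ) (hβ : 0 < β)
    (hγ : γ ^ 2 / β * frobInner X X ≤ τ / 4) :
    Tendsto (fun k => frobInner (U (k + 2) - U (k + 1)) (U (k + 2) - U (k + 1)))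
      atTop (𝓝 0) := by
  have := tendsto_zero_of_le_sub
    (a := fun k => β / 4 * frobInner (U (k + 2) - U (k + 1)) (U (k + 2) - U (k + 1)))
    (fun k => mul_nonneg (by positivity) (frobInner_self_nonneg _))
    (fun k => le_trans (le_add_of_nonneg_left (mul_nonneg (by positivity)
      (frobInner_self_nonneg _))) (h.potential_step hβ hγ k)) (h.bddAbove_potential hτ hβ)
  simpa [← mul_assoc, hβ.ne'] using this.const_mul (4 / β)

/-- Distinct entries in {-1, 0, 1} differ by at least 1. -/
lemma eq_of_frobInner_sub_lt_one {m k : ℕ} {A B : Matrix (Fin m) (Fin k) ℝ}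
    (hA : A ∈ signMatrices m k) (hB : B ∈ signMatrices m k)
    (h : frobInner (A - B) (A - B) < 1) : A = B := by
  ext i j
  have hij := (sq_apply_le_frobInner_self (A - B) i j).trans_lt h
  rw [Matrix.sub_apply] at hij
  rcases hA i j with ha | ha | ha <;> rcases hB i j with hb | hb | hb <;>
    rw [ha, hb] at hij ⊢ <;> norm_num at hij

lemma tendsto_zero_of_tendsto_frobInner {m k : ℕ} {A : ℕ → Matrix (Fin m) (Fin k) ℝ}
    (h : Tendsto (fun l => frobInner (A l) (A l)) atTop (𝓝 0)) : Tendsto A atTop (𝓝 0) := by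
  refine tendsto_pi_nhds.2 fun i => tendsto_pi_nhds.2 fun j => ?_
  have hsq : Tendsto (fun l => A l i j ^ 2) atTop (𝓝 0) :=
    squeeze_zero (fun _ => sq_nonneg _) (fun l => sq_apply_le_frobInner_self (A l) i j) h
  have := (Real.continuous_sqrt.tendsto 0).comp hsq
  rw [Real.sqrt_zero] at this
  exact (tendsto_zero_iff_abs_tendsto_zero _).2
    (this.congr fun l => by simp [Real.sqrt_sq_eq_abs])

lemma IsPAMe.exists_eventually_const (h : IsPAMe X τ β γ U S E) (hτ : 0 < τ) (hβ : 0 < β)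
    (hγ : γ ^ 2 / β * frobInner X X ≤ τ / 4) : ∃ k, ∀ m, k ≤ m → S m = S k := by
  obtain ⟨N, hN⟩ := eventually_atTop.1
    ((h.tendsto_frobInner_S hτ hβ hγ).eventually (gt_mem_nhds one_pos))
  refine ⟨N + 1, fun m hm => ?_⟩
  induction m, hm using Nat.le_induction with
  | base => rfl
  | succ m hm ih =>
    obtain ⟨l, rfl⟩ : ∃ l, m = l + 1 := ⟨m - 1, by omega⟩
    rw [← ih]
    exact eq_of_frobInner_sub_lt_one (h.mem_signMatrices _) (h.mem_signMatrices _)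
      (hN l (by omega))

/-- Accumulation points of the `U`-iterates, once the sign variable is constant. -/
lemma IsPAMe.exists_limit (h : IsPAMe X τ β γ U S E) (hτ : 0 < τ) (hβ : 0 < β)
    (hγ : γ ^ 2 / β * frobInner X X ≤ τ / 4) {k₀ : ℕ} {T : Matrix (Fin n) (Fin K) ℝ}
    (hT : ∀ k, k₀ ≤ k → S k = T) :
    ∃ V, IsUFactor (β • V + X * T) V ∧
      oneNorm (Xᵀ * V) - frobInner T (Xᵀ * V) ≤ 2 * τ * (n * K) := by
  have hD : Tendsto (fun k => U (k + 2) - U (k + 1)) atTop (𝓝 0) :=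
    tendsto_zero_of_tendsto_frobInner (h.tendsto_frobInner_U hτ hβ hγ)
  have : FirstCountableTopology (Matrix (Fin d) (Fin K) ℝ) :=
    inferInstanceAs (FirstCountableTopology (Fin d → Fin K → ℝ))
  obtain ⟨V, -, φ, hφ, hV⟩ := (isCompact_stiefel d K).tendsto_subseq
    (fun k => h.mem_stiefel (k + 1))
  -- Increments vanish, so consecutive `U`-iterates and the extrapolated `E` share the limit `V`,
  -- and both update rules pass to the limit.
  have hDφ := hD.comp hφ.tendsto_atTop
  have hV' : Tendsto (fun l => U (φ l + 2)) atTop (𝓝 V) := by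
    have := hDφ.add hV
    rw [zero_add] at this
    exact this.congr fun l => by simp
  have hE : Tendsto (fun l => E (φ l + 2)) atTop (𝓝 V) := by
    have := hV'.add (hDφ.const_smul γ)
    rw [smul_zero, add_zero] at this
    refine this.congr fun l => ?_
    rw [h.step_E (φ l + 1)]
    simp only [Function.comp_apply, ← neg_sub (U (φ l + 2)) (U (φ l + 1)), smul_neg,
      sub_neg_eq_add]
  have hlarge : ∀ᶠ l in atTop, k₀ ≤ φ l := hφ.tendsto_atTop.eventually_ge_atTop k₀
  refine ⟨V, ?_, ?_⟩
  · have hpair : Tendsto (fun l => (β • U (φ l + 1) + X * T, U (φ l + 2))) atTop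
        (𝓝 (β • V + X * T, V)) :=
      ((hV.const_smul β).add_const _).prodMk_nhds hV'
    refine (isClosed_isUFactor d K).mem_of_tendsto hpair ?_
    filter_upwards [hlarge] with l hl
    have := h.step_U (φ l + 1)
    rwa [hT (φ l + 1 + 1) (by omega)] at this
  · have hcont := ((continuous_oneNorm_sub_frobInner X T).tendsto V).comp hE
    refine le_of_tendsto hcont ?_
    filter_upwards [hlarge] with l hl
    have hfix : ∀ i j, T i j = Real.sign (τ * T i j + (Xᵀ * E (φ l + 2)) i j) := by
      intro i j
      have := h.apply_S (φ l + 2) i j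
      rwa [hT (φ l + 2 + 1) (by omega), hT (φ l + 2) (by omega)] at this
    simp only [Function.comp_apply, oneNorm, frobInner, ← Finset.sum_sub_distrib]
    calc _ ≤ ∑ _i : Fin n, ∑ _j : Fin K, 2 * τ :=
          Finset.sum_le_sum fun i _ => Finset.sum_le_sum fun j _ => by
            have := abs_le_of_sign_eq hτ (hfix i j)
            linarith
      _ = 2 * τ * (n * K) := by
          simp only [Finset.sum_const, Finset.card_univ, Fintype.card_fin, nsmul_eq_mul]
          ring

end L1PCA

theorem mainTheorem4 {d n K : ℕ} (X : Matrix (Fin d) (Fin n) ℝ) :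
    ∃ τ₀ : ℝ, 0 < τ₀ ∧ ∃ β₀ : ℝ, 0 < β₀ ∧
    ∀ τ β : ℝ, 0 < τ → 0 < β →
    ∃ γ₀ : ℝ, 0 < γ₀ ∧
    ∀ γ : ℝ, 0 ≤ γ → γ < 1 → γ < γ₀ →
    ∀ (U : ℕ → Matrix (Fin d) (Fin K) ℝ) (S : ℕ → Matrix (Fin n) (Fin K) ℝ)
      (E : ℕ → Matrix (Fin d) (Fin K) ℝ), L1PCA.IsPAMe X τ β γ U S E →
    ∃ (k' : ℕ) (Sstar : Matrix (Fin n) (Fin K) ℝ),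
      -- the sign variable is constant from the first index `k'` on
      (IsLeast {k : ℕ | ∀ m, k ≤ m → S m = S k} k' ∧ ∀ k, k' ≤ k → S k = Sstar) ∧
      -- small `τ`: a KKT point; small `τ` and `β`: a `U`-factor of `X S*` that is a FOC point
      (τ < τ₀ → ∃ Ustar : Matrix (Fin d) (Fin K) ℝ,
        (L1PCA.IsUFactor (β • Ustar + X * Sstar) Ustar ∧
          Sstar ∈ L1PCA.subdiffOneNorm (X.transpose * Ustar) ∧
          L1PCA.IsKKT X Ustar) ∧
        (β < β₀ → L1PCA.IsUFactor (X * Sstar) Ustar ∧ L1PCA.IsFOC X Ustar)) ∧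
      -- full rank: the `U`-factor of `X S^{k'}` is unique, and it is a FOC point
      (τ < τ₀ → β < β₀ → (X * Sstar).rank = K →
        ∃ V : Matrix (Fin d) (Fin K) ℝ,
          L1PCA.IsUFactor (X * S k') V ∧
          (∀ V', L1PCA.IsUFactor (X * S k') V' → V' = V) ∧
          L1PCA.IsFOC X V) := by
  classical
  obtain ⟨ε, hε, hthr⟩ := L1PCA.exists_thresholds (k := K) X
  have hnK : (0 : ℝ) < 2 * (n * K) + 1 := by positivity
  -- The accumulated sign error is at most 2τnK; the added 1 keeps the denominator positive when nK
  -- = 0.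
  refine ⟨ε / (2 * (n * K) + 1), by positivity, ε, hε, fun τ β hτ hβ => ?_⟩
  have hX := L1PCA.frobInner_self_nonneg X
  -- Chosen so that the Young remainder γ²‖X‖²/β stays below τ/4; the added 1 covers X = 0.
  refine ⟨√(τ * β / (4 * (L1PCA.frobInner X X + 1))), by positivity, ?_⟩
  intro γ hγ0 _ hγ U S E h
  have hγ' : γ ^ 2 / β * L1PCA.frobInner X X ≤ τ / 4 := by
    have hsq : γ ^ 2 < τ * β / (4 * (L1PCA.frobInner X X + 1)) := (Real.lt_sqrt hγ0).1 hγ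
    rw [lt_div_iff₀ (by positivity)] at hsq
    rw [div_mul_eq_mul_div, div_le_iff₀ hβ]
    nlinarith [sq_nonneg γ]
  have hex := h.exists_eventually_const hτ hβ hγ'
  refine ⟨Nat.find hex, S (Nat.find hex), ⟨⟨Nat.find_spec hex, fun k hk => Nat.find_min' hex hk⟩,
    Nat.find_spec hex⟩, ?_⟩
  have hconst := Nat.find_spec hex
  have hsign := h.mem_signMatrices (Nat.find hex)
  generalize S (Nat.find hex) = T at hconst hsign ⊢
  have main : τ < ε / (2 * (n * K) + 1) → ∃ V : Matrix (Fin d) (Fin K) ℝ,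
      (L1PCA.IsUFactor (β • V + X * T) V ∧ T ∈ L1PCA.subdiffOneNorm (X.transpose * V) ∧
        L1PCA.IsKKT X V) ∧ (β < ε → L1PCA.IsUFactor (X * T) V ∧ L1PCA.IsFOC X V) := by
    intro hτ₀
    obtain ⟨W, hW, hWε⟩ := h.exists_limit hτ hβ hγ' hconst
    obtain ⟨b, hbT, hbβ, hWb⟩ := hW.exists_criticalShift hβ.le
    have herr : 2 * τ * (n * K) ≤ ε := by
      rw [lt_div_iff₀ hnK] at hτ₀
      linarith
    obtain ⟨hb0, hgood⟩ := hthr T hsign b hbT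
    obtain ⟨V, hVb, hVT⟩ := hgood W hWb (hWε.trans herr)
    -- The exact point was found at the lowered shift `b`; enlarging a shift keeps bI + VᵀC positive
    -- semidefinite, so `β` is admissible again.
    have hVβ := hVb.smul_add_mono hbβ
    refine ⟨V, ⟨hVβ, hVT, hVb.1, _, hVb.isSymm_transpose_mul, T, hVT,
      (L1PCA.isUFactor_smul_add_iff.1 hVb).2.2⟩, fun hβ₀ => ?_⟩
    have hV : L1PCA.IsUFactor (X * T) V := by
      rwa [hb0 (hbβ.trans_lt hβ₀), zero_smul, zero_add] at hVb
    exact ⟨hV, T, hVT, hV⟩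
  refine ⟨main, fun hτ₀ hβ₀ hrank => ?_⟩
  obtain ⟨V, -, hV⟩ := main hτ₀
  exact ⟨V, (hV hβ₀).1, fun V' hV' => (hV hβ₀).1.eq_of_rank_eq hrank hV', (hV hβ₀).2⟩
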